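/- **Conventions.** $[0]$ (two horizontal arcs), $[\infty]$ (two vertical arcs) and $[\pm1]$ (one crossing) are the elementary tangles with end points NW, NE, SW, SE; $T+S$ puts $S$ to the right of $T$, $T*S$ puts $S$ below $T$. A *rational tangle diagram in twist form* is a diagram obtained from $[0]$ or $[\infty]$ by finitely many operations $T\mapsto T+[\pm1]$, $[\pm1]+T$, $T*[\pm1]$, $[\pm1]*T$. A diagram is *alternating* if crossings alternate between over and under along its strands. The *smoothings* of a crossing replace it by $[0]$ or by $[\infty]$. A connected link diagram has a *nugatory crossing* if some smoothing of this crossing disconnects the diagram; for a connected tangle diagram, a crossing is nugatory if some smoothing of it splits off a component containing none of the four end points. A (link or tangle) diagram is *reduced* if it is connected and has no nugatory crossing. A *coloring* of a diagram in a commutative ring $R$ assigns an element of $R$ to every arc such that $\alpha+\gamma=2\beta$ whenever undercrossing arcs colored $\alpha,\gamma$ meet at an overcrossing arc colored $\beta$; it is *nontrivial* if it is not constant. The *numerator closure* $N(T)$ is the link diagram obtained by joining the two upper and the two lower end points of $T$. For a link diagram $K$, $v(K)$ is its number of crossings and $\mathrm{Det}(K)=|\langle K\rangle(\sqrt i)|$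 is its determinant, where $\langle K\rangle(A)$ is the Kauffman bracket. **Theorem 5.** Let $T$ be an alternating rational tangle diagram in twist form. (1) If $T$ is reduced, then in every nontrivial coloring of $T$ over $\mathbb Z$ the colors of the arcs of $T$ are pairwise distinct. (2) Let $K=N(T)$ be its numerator closure. If the link diagram $K$ is reduced and $\mathrm{Det}(K)$ is a prime number $p$, then in every nontrivial coloring of $K$ in $\mathbb Z/p\mathbb Z$ the colors of the arcs of $K$ are pairwise distinct, and there are exactly $v(K)$ distinct colors. (Thus the Kauffman–Harary conjecture, that every nontrivial coloring in $\mathbb Z/p\mathbb Z$ of a reduced alternating link diagram $K$ of prime determinant $p$ has $v(K)$ distinct colors, holds for these diagrams of rational links.) -/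

import Mathlib

/-- The four corners of a crossing, and also the four end positions of a 2-tangle:
northwest, northeast, southwest, southeast. -/
inductive Corner where
  | nw | ne | sw | se

/-- The two ways of smoothing a crossing: replacing it by the tangle `[0]` (two horizontal arcs)
or by the tangle `[∞]` (two vertical arcs). -/
inductive Smoothing where
  | zero | infty
  deriving DecidableEq

instance : Fintype Smoothing where
  elems := {.zero, .infty}
  complete s := by cases s <;> simp

/-- The corners that a smoothing connects with each other. -/
def Smoothing.Joins : Smoothing → Corner → Corner → Prop
  | .zero, .nw, .ne => True
  | .zero, .sw, .se => True
  | .infty, .nw, .sw => True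
  | .infty, .ne, .se => True
  | _, _, _ => False

/-- A diagram, recorded as a planar diagram code.  The plane curves are cut at the crossings into
edges; every crossing is placed upright, as one of the tangles `[+1]`, `[-1]`, and `corner c i` is
the edge that leaves the crossing `c` at its corner `i`.  An edge that is the corner of no crossing
is a simple closed curve (or, in a tangle, a strand) without crossings. -/
structure Diagram where
  Edge : Type
  Crossing : Type
  [finiteEdge : Finite Edge]
  [fintypeCrossing : Fintype Crossing]
  corner : Crossing → Corner → Edge
  /-- `true` for the tangle `[+1]`, whose overcrossing strand runs from `nw` to `se`;
  `false` for the tangle `[-1]`, whose overcrossing strand runs from `sw` to `ne`. -/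
  positive : Crossing → Bool

attribute [instance] Diagram.finiteEdge Diagram.fintypeCrossing

namespace Diagram

variable (D : Diagram)

/-- Is the strand of `c` that leaves at the corner `i` the overcrossing one? -/
def IsOver (c : D.Crossing) : Corner → Prop
  | .nw => D.positive c = true
  | .se => D.positive c = true
  | .ne => D.positive c = false
  | .sw => D.positive c = false

/-- The relation between edges "`e` and `f` lie at corners `i`, `k` of one crossing `c`, and these
corners are connected there according to `J c i k`". -/
def Joined (J : D.Crossing → Corner → Corner → Prop) (e f : D.Edge) : Prop :=
  ∃ c i k, J c i k ∧ D.corner c i = e ∧ D.corner c k = f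

/-- The arcs of the diagram: the edges, with the two edges of each overcrossing strand identified.
An arc runs from one undercrossing (or end point) to the next. -/
def Arc : Type := Quot (D.Joined fun c i k => D.IsOver c i ∧ D.IsOver c k)

/-- The arc that leaves a crossing at a given corner. -/
def arcAt (c : D.Crossing) (i : Corner) : D.Arc := Quot.mk _ (D.corner c i)

/-- The overcrossing arc of a crossing. -/
def overArc (c : D.Crossing) : D.Arc :=
  if D.positive c then D.arcAt c .nw else D.arcAt c .ne

/-- The upper one of the two undercrossing arcs of a crossing. -/
def upperUnderArc (c : D.Crossing) : D.Arc :=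
  if D.positive c then D.arcAt c .ne else D.arcAt c .nw

/-- The lower one of the two undercrossing arcs of a crossing. -/
def lowerUnderArc (c : D.Crossing) : D.Arc :=
  if D.positive c then D.arcAt c .sw else D.arcAt c .se

/-- A coloring of the arcs by elements of `R`: if undercrossing arcs colored `α` and `γ` meet at an
overcrossing arc colored `β`, then `α + γ = 2β`. -/
structure Coloring (R : Type) [CommRing R] where
  color : D.Arc → R
  rule : ∀ c, color (D.upperUnderArc c) + color (D.lowerUnderArc c) = 2 * color (D.overArc c)

/-- A coloring is nontrivial if it is not constant. -/
def Coloring.Nontrivial {D : Diagram} {R : Type} [CommRing R] (C : D.Coloring R) : Prop :=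
  ∃ x y, C.color x ≠ C.color y

/-- Crossings alternate from under to over along the strands: each edge that joins two crossing
corners is an overcrossing strand at one of them and an undercrossing strand at the other. -/
def Alternating : Prop :=
  ∀ c i c' i', (c, i) ≠ (c', i') → D.corner c i = D.corner c' i' → (D.IsOver c i ↔ ¬ D.IsOver c' i')

/-- The connected components of the diagram, viewed as a subset of the plane. -/
def Component : Type := Quot (D.Joined fun _ _ _ => True)

/-- The diagram is connected, viewed as a subset of the plane. -/
def Connected : Prop := Nonempty D.Component ∧ Subsingleton D.Component

/-- The connected components, viewed as subsets of the plane, of the diagram obtained by applying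
the smoothing `s` to the crossing `c` and to no other crossing. -/
def SmoothedComponent (c : D.Crossing) (s : Smoothing) : Type :=
  Quot (D.Joined fun c' i k => c' = c → s.Joins i k)

/-- Nugatory crossing of a link diagram: one of its smoothings disconnects the diagram. -/
def IsNugatory (c : D.Crossing) : Prop :=
  ∃ s, ∃ x y : D.SmoothedComponent c s, x ≠ y

/-- A link diagram is reduced if it is connected and has no nugatory crossing. -/
def Reduced : Prop := D.Connected ∧ ∀ c, ¬ D.IsNugatory c

/-- The number `v` of crossings. -/
def numCrossings : ℕ := Fintype.card D.Crossing

/-- The number of closed curves that are left when every crossing of a link diagram is smoothed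
according to the state `s`. -/
noncomputable def numLoops (s : D.Crossing → Smoothing) : ℕ :=
  Nat.card (Quot (D.Joined fun c i k => (s c).Joins i k))

/-- The weight of a smoothed crossing in the Kauffman bracket: `A` for the smoothing that connects
the two regions swept out by the overcrossing strand when it is turned counterclockwise up to the
undercrossing strand, and `A⁻¹` for the other one. -/
noncomputable def smoothingWeight (A : ℂ) (c : D.Crossing) : Smoothing → ℂ
  | .zero => if D.positive c then A else A⁻¹
  | .infty => if D.positive c then A⁻¹ else A

open Classical in
/-- The value at `A ≠ 0` of the Kauffman bracket of a link diagram, as a sum over all states; it is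
normalized to be `1` for a circle without crossings. -/
noncomputable def kauffmanBracket (A : ℂ) : ℂ :=
  ∑ s : D.Crossing → Smoothing,
    (∏ c, D.smoothingWeight A c (s c)) * (-A ^ 2 - A⁻¹ ^ 2) ^ (D.numLoops s - 1)

/-- The determinant of a link diagram: the absolute value of the Kauffman bracket at `A = √i`. -/
noncomputable def determinant : ℝ :=
  ‖D.kauffmanBracket (Complex.exp (Real.pi * Complex.I / 4))‖

end Diagram

/-- A 2-tangle diagram: a diagram with four end points, `tip i` being the edge that ends at the
position `i`. -/
structure TangleDiagram extends Diagram where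
  tip : Corner → Edge

namespace TangleDiagram

/-- The tangle `[0]`: two horizontal arcs. -/
def zero : TangleDiagram where
  Edge := Bool
  Crossing := Empty
  corner := nofun
  positive := nofun
  tip
    | .nw => true
    | .ne => true
    | .sw => false
    | .se => false

/-- The tangle `[∞]`: two vertical arcs. -/
def infty : TangleDiagram where
  Edge := Bool
  Crossing := Empty
  corner := nofun
  positive := nofun
  tip
    | .nw => true
    | .sw => true
    | .ne => false
    | .se => false

variable (T : TangleDiagram)

/-- `T` with two new edges and one new crossing `none`, of type `[+1]` if `ε` is `true` and `[-1]`
if `ε` is `false`, with corners `newCorner`; the four ends of the result are `newTip`. -/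
def attach (ε : Bool) (newCorner newTip : Corner → T.Edge ⊕ Bool) : TangleDiagram where
  Edge := T.Edge ⊕ Bool
  Crossing := Option T.Crossing
  corner
    | none, i => newCorner i
    | some c, i => Sum.inl (T.corner c i)
  positive
    | none => ε
    | some c => T.positive c
  tip := newTip

/-- `T + [±1]` -/
def addRight (ε : Bool) : TangleDiagram :=
  T.attach ε
    (fun
      | .nw => .inl (T.tip .ne)
      | .sw => .inl (T.tip .se)
      | .ne => .inr true
      | .se => .inr false)
    (fun
      | .nw => .inl (T.tip .nw)
      | .sw => .inl (T.tip .sw)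
      | .ne => .inr true
      | .se => .inr false)

/-- `[±1] + T` -/
def addLeft (ε : Bool) : TangleDiagram :=
  T.attach ε
    (fun
      | .nw => .inr true
      | .sw => .inr false
      | .ne => .inl (T.tip .nw)
      | .se => .inl (T.tip .sw))
    (fun
      | .nw => .inr true
      | .sw => .inr false
      | .ne => .inl (T.tip .ne)
      | .se => .inl (T.tip .se))

/-- `T * [±1]`, the new crossing being below `T` -/
def mulBottom (ε : Bool) : TangleDiagram :=
  T.attach ε
    (fun
      | .nw => .inl (T.tip .sw)
      | .ne => .inl (T.tip .se)
      | .sw => .inr true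
      | .se => .inr false)
    (fun
      | .nw => .inl (T.tip .nw)
      | .ne => .inl (T.tip .ne)
      | .sw => .inr true
      | .se => .inr false)

/-- `[±1] * T`, the new crossing being above `T` -/
def mulTop (ε : Bool) : TangleDiagram :=
  T.attach ε
    (fun
      | .nw => .inr true
      | .ne => .inr false
      | .sw => .inl (T.tip .nw)
      | .se => .inl (T.tip .ne))
    (fun
      | .nw => .inr true
      | .ne => .inr false
      | .sw => .inl (T.tip .sw)
      | .se => .inl (T.tip .se))

/-- Rational tangle diagrams in twist form: those created by consecutive additions and
multiplications, on either side, by `[±1]`, starting from `[0]` or `[∞]`. -/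
inductive IsTwistForm : TangleDiagram → Prop
  | zero : IsTwistForm zero
  | infty : IsTwistForm infty
  | addRight (T : TangleDiagram) (ε : Bool) : IsTwistForm T → IsTwistForm (T.addRight ε)
  | addLeft (T : TangleDiagram) (ε : Bool) : IsTwistForm T → IsTwistForm (T.addLeft ε)
  | mulBottom (T : TangleDiagram) (ε : Bool) : IsTwistForm T → IsTwistForm (T.mulBottom ε)
  | mulTop (T : TangleDiagram) (ε : Bool) : IsTwistForm T → IsTwistForm (T.mulTop ε)

/-- Nugatory crossing of a tangle diagram: one of its smoothings splits off a component of the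
diagram that contains none of the four end points.  (The rest of the diagram is attached to the
outside through the end points.) -/
def IsNugatoryCrossing (c : T.Crossing) : Prop :=
  ∃ s, ∃ x : T.SmoothedComponent c s, ∀ i, Quot.mk _ (T.tip i) ≠ x

/-- A tangle diagram is reduced if it is connected and has no nugatory crossing. -/
def IsReduced : Prop := T.Connected ∧ ∀ c, ¬ T.IsNugatoryCrossing c

/-- The numerator closure `N(T)`: the two upper ends are joined by a simple arc, and so are the two
lower ends. -/
def numerator : Diagram where
  Edge := Quot fun e f : T.Edge =>
    (e = T.tip .nw ∧ f = T.tip .ne) ∨ (e = T.tip .sw ∧ f = T.tip .se)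
  Crossing := T.Crossing
  corner c i := Quot.mk _ (T.corner c i)
  positive := T.positive

end TangleDiagram

/-! Absence of nugatory crossings forces an alternating twist form to be built from `[0]` or `[∞]`
by crossings of a single type `ε`, never adding horizontally to `[∞]` nor vertically to `[0]`. Such
a tangle carries two numbers `h` and `u`: a horizontal addition turns them into `h + u`, `u`, a
vertical one into `h`, `u + h`.

The tangle has an integral coloring `κ` with values in an interval `[m, m + h + u]`, whose extreme
colors sit at two diagonally opposite ends. Because the diagram alternates, the overcrossing strand
of an added crossing continues one of these extreme ends. The color created by the crossing is the
reflection of an adjacent end color in the extreme color, so it falls strictly outside the old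
interval. Hence every crossing creates exactly one new arc and one new color: colors separate arcs,
and there are `v + 2` of them. The crossing rules also propagate every coloring from the two initial
strands, so each coloring over any ring is `x + κ * y`. Over `ℤ` nontriviality means `y ≠ 0`, and
injectivity follows (`IsBasicColoring.attach`, `IsBasicColoring.injective_color`).

For the closure, the states contributing to the bracket at `A = √i` are those with one closed curve.
Alternation makes their contributions add without cancellation, so the determinant is `h`
(`IsAlternatingTwist.exists_closureSum`). In a reduced closure of prime determinant the last
operation is a horizontal addition. The colors before it fill an interval of width exactly the new
`h`, whose extremes are identified by the closure; the one later color is identified with a color of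
that interval. Modulo the prime nothing else coincides, which leaves `v` colors on `v` arcs
(`IsBasicColoring.numerator`). -/

namespace Diagram

/-! ### Edge colorings and tests for nugatory crossings. -/

variable {D : Diagram}

/-- A coloring in terms of edges: it is constant along overcrossing strands and satisfies the
coloring rule. -/
def IsEdgeColoring (D : Diagram) {R : Type} [CommRing R] (g : D.Edge → R) : Prop :=
  ∀ c, (D.positive c = true → g (D.corner c .nw) = g (D.corner c .se) ∧
      g (D.corner c .ne) + g (D.corner c .sw) = 2 * g (D.corner c .nw)) ∧
    (D.positive c = false → g (D.corner c .ne) = g (D.corner c .sw) ∧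
      g (D.corner c .nw) + g (D.corner c .se) = 2 * g (D.corner c .ne))

theorem arcAt_eq_of_isOver {c : D.Crossing} {i k : Corner} (hi : D.IsOver c i)
    (hk : D.IsOver c k) : D.arcAt c i = D.arcAt c k :=
  Quot.sound ⟨c, i, k, ⟨hi, hk⟩, rfl, rfl⟩

theorem Coloring.isEdgeColoring {R : Type} [CommRing R] (C : D.Coloring R) :
    D.IsEdgeColoring fun e => C.color (Quot.mk _ e) := by
  intro c
  have hr := C.rule c
  refine ⟨fun h => ⟨?_, ?_⟩, fun h => ⟨?_, ?_⟩⟩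
  · exact congrArg C.color (arcAt_eq_of_isOver (i := .nw) (k := .se) h h)
  · simp only [upperUnderArc, lowerUnderArc, overArc, h, if_true] at hr
    exact hr
  · exact congrArg C.color (arcAt_eq_of_isOver (i := .ne) (k := .sw) h h)
  · simp only [upperUnderArc, lowerUnderArc, overArc, h, if_false, Bool.false_eq_true] at hr
    exact hr

/-- Crossing `c` of a link diagram is nugatory if some function on the edges is not constant, but
constant on the connected components after a smoothing of `c`. -/
theorem isNugatory_of_invariant {c : D.Crossing} (s : Smoothing) (f : D.Edge → Prop)
    (hf : ∀ c' i k, (c' = c → s.Joins i k) → f (D.corner c' i) = f (D.corner c' k))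
    {e e' : D.Edge} (he : f e) (he' : ¬ f e') : D.IsNugatory c := by
  refine ⟨s, Quot.mk _ e, Quot.mk _ e', fun h => he' ?_⟩
  have := congrArg (Quot.lift f (by rintro _ _ ⟨c', i, k, hJ, rfl, rfl⟩; exact hf c' i k hJ)) h
  exact this.mp he

end Diagram

namespace TangleDiagram

open Diagram

variable {T : TangleDiagram}

/-- The predicate is the indicator of a union of components avoiding the ends. Working with
predicates on edges avoids quotients when the diagram is enlarged or closed. -/
theorem isNugatoryCrossing_iff {c : T.Crossing} : T.IsNugatoryCrossing c ↔
    ∃ s : Smoothing, ∃ f : T.Edge → Prop,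
      (∀ c' i k, (c' = c → s.Joins i k) → f (T.corner c' i) = f (T.corner c' k)) ∧
      (∀ i, ¬ f (T.tip i)) ∧ ∃ e, f e := by
  constructor
  · rintro ⟨s, x, hx⟩
    refine ⟨s, fun e => Quot.mk _ e = x, fun c' i k h => ?_, hx, ?_⟩
    · exact congrArg (· = x) (Quot.sound ⟨c', i, k, h, rfl, rfl⟩)
    · induction x using Quot.ind with | mk e => exact ⟨e, rfl⟩
  · rintro ⟨s, f, hf, ht, e, he⟩
    refine ⟨s, Quot.mk _ e, fun i h => ht i ?_⟩
    have := congrArg (Quot.lift f (by rintro _ _ ⟨c', i, k, hJ, rfl, rfl⟩; exact hf c' i k hJ)) h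
    exact this.mpr he

theorem IsNugatoryCrossing.attach {c : T.Crossing} (hc : T.IsNugatoryCrossing c) (ε : Bool)
    {newCorner newTip : Corner → T.Edge ⊕ Bool}
    (hcorner : ∀ i, (∃ k, newCorner i = .inl (T.tip k)) ∨ ∃ b, newCorner i = .inr b)
    (htip : ∀ i, (∃ k, newTip i = .inl (T.tip k)) ∨ ∃ b, newTip i = .inr b) :
    (T.attach ε newCorner newTip).IsNugatoryCrossing (some c) := by
  obtain ⟨s, f, hf, ht, e, he⟩ := isNugatoryCrossing_iff.1 hc
  -- The split-off part misses all ends, so its extension by `False` is constantly false at the new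
  -- crossing and at the new ends.
  have key : ∀ g : Corner → T.Edge ⊕ Bool,
      (∀ i, (∃ k, g i = .inl (T.tip k)) ∨ ∃ b, g i = .inr b) →
      ∀ i, ¬ Sum.elim f (fun _ => False) (g i) := by
    intro g hg i
    obtain ⟨k, hk⟩ | ⟨b, hb⟩ := hg i
    · simpa [hk] using ht k
    · simp [hb]
  refine isNugatoryCrossing_iff.2 ⟨s, Sum.elim f fun _ => False, ?_, key _ htip, .inl e, he⟩
  rintro (_ | c') i k h
  · have hi := key _ hcorner i
    have hk := key _ hcorner k
    exact propext (iff_of_false hi hk)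
  · exact hf c' i k fun h' => h (congrArg some h')

theorem IsNugatoryCrossing.numerator {c : T.Crossing} (hc : T.IsNugatoryCrossing c) :
    T.numerator.IsNugatory c := by
  obtain ⟨s, f, hf, ht, e, he⟩ := isNugatoryCrossing_iff.1 hc
  refine isNugatory_of_invariant s (Quot.lift f ?_) (fun c' i k h => hf c' i k h)
    (e := Quot.mk _ e) (e' := Quot.mk _ (T.tip .nw)) he (ht _)
  rintro _ _ (⟨rfl, rfl⟩ | ⟨rfl, rfl⟩)
  all_goals exact propext (iff_of_false (ht _) (ht _))

/-- The right strand of `[∞]` has both its ends at the new crossing, so the vertical smoothing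
closes it to a circle. The three analogous lemmas below exhibit the same kind of kink. -/
theorem isNugatoryCrossing_infty_addRight (ε : Bool) :
    (infty.addRight ε).IsNugatoryCrossing none := by
  refine isNugatoryCrossing_iff.2 ⟨.infty, fun e => e = .inl false, ?_, ?_, _, rfl⟩
  · rintro (_ | ⟨⟨⟩⟩) (_ | _ | _ | _) (_ | _ | _ | _) h <;>
      first | rfl | exact (h rfl).elim | skip
    all_goals simp [addRight, TangleDiagram.attach, infty]
  · rintro (_ | _ | _ | _) <;> simp [addRight, TangleDiagram.attach, infty]

theorem isNugatoryCrossing_infty_addLeft (ε : Bool) :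
    (infty.addLeft ε).IsNugatoryCrossing none := by
  refine isNugatoryCrossing_iff.2 ⟨.infty, fun e => e = .inl true, ?_, ?_, _, rfl⟩
  · rintro (_ | ⟨⟨⟩⟩) (_ | _ | _ | _) (_ | _ | _ | _) h <;>
      first | rfl | exact (h rfl).elim | skip
    all_goals simp [addLeft, TangleDiagram.attach, infty]
  · rintro (_ | _ | _ | _) <;> simp [addLeft, TangleDiagram.attach, infty]

theorem isNugatoryCrossing_zero_mulBottom (ε : Bool) :
    (zero.mulBottom ε).IsNugatoryCrossing none := by
  refine isNugatoryCrossing_iff.2 ⟨.zero, fun e => e = .inl false, ?_, ?_, _, rfl⟩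
  · rintro (_ | ⟨⟨⟩⟩) (_ | _ | _ | _) (_ | _ | _ | _) h <;>
      first | rfl | exact (h rfl).elim | skip
    all_goals simp [mulBottom, TangleDiagram.attach, zero]
  · rintro (_ | _ | _ | _) <;> simp [mulBottom, TangleDiagram.attach, zero]

theorem isNugatoryCrossing_zero_mulTop (ε : Bool) :
    (zero.mulTop ε).IsNugatoryCrossing none := by
  refine isNugatoryCrossing_iff.2 ⟨.zero, fun e => e = .inl true, ?_, ?_, _, rfl⟩
  · rintro (_ | ⟨⟨⟩⟩) (_ | _ | _ | _) (_ | _ | _ | _) h <;>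
      first | rfl | exact (h rfl).elim | skip
    all_goals simp [mulTop, TangleDiagram.attach, zero]
  · rintro (_ | _ | _ | _) <;> simp [mulTop, TangleDiagram.attach, zero]

/-- The closure joins the two new lower ends to each other, and the horizontal smoothing cuts the
resulting curve off from `T`. -/
theorem isNugatory_numerator_mulBottom (T : TangleDiagram) (ε : Bool) :
    (T.mulBottom ε).numerator.IsNugatory none := by
  refine isNugatory_of_invariant .zero
    (Quot.lift (Sum.elim (fun _ => False) fun _ => True) ?_) ?_
    (e := Quot.mk _ (.inr true)) (e' := Quot.mk _ (.inl (T.tip .nw))) trivial id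
  · rintro _ _ (⟨rfl, rfl⟩ | ⟨rfl, rfl⟩) <;> rfl
  · rintro (_ | c) (_ | _ | _ | _) (_ | _ | _ | _) h <;> first | rfl | exact (h rfl).elim

theorem isNugatory_numerator_mulTop (T : TangleDiagram) (ε : Bool) :
    (T.mulTop ε).numerator.IsNugatory none := by
  refine isNugatory_of_invariant .zero
    (Quot.lift (Sum.elim (fun _ => False) fun _ => True) ?_) ?_
    (e := Quot.mk _ (.inr true)) (e' := Quot.mk _ (.inl (T.tip .sw))) trivial id
  · rintro _ _ (⟨rfl, rfl⟩ | ⟨rfl, rfl⟩) <;> rfl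
  · rintro (_ | c) (_ | _ | _ | _) (_ | _ | _ | _) h <;> first | rfl | exact (h rfl).elim

theorem not_connected_numerator_zero : ¬ zero.numerator.Connected := by
  rintro ⟨-, h⟩
  let f : zero.numerator.Component → Prop := Quot.lift
    (Quot.lift (fun e : Bool => e = true) (by rintro _ _ (⟨rfl, rfl⟩ | ⟨rfl, rfl⟩) <;> rfl))
    (by rintro _ _ ⟨⟨⟩, _⟩)
  have := congrArg f (h.elim (Quot.mk _ (Quot.mk _ true)) (Quot.mk _ (Quot.mk _ false)))
  exact absurd (this.mp rfl) Bool.false_ne_true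

/-! ### Structure of alternating twist forms without nugatory crossings. -/

/-- The alternating rational tangle diagrams in twist form, with crossings of type `ε`, that are
built without creating a nugatory crossing.  The numbers `h` and `u` are the determinants of the
numerator and of the denominator closure. -/
inductive IsAlternatingTwist (ε : Bool) : TangleDiagram → ℕ → ℕ → Prop
  | zero : IsAlternatingTwist ε zero 0 1
  | infty : IsAlternatingTwist ε infty 1 0
  | addRight {T : TangleDiagram} {h u : ℕ} : 0 < u → IsAlternatingTwist ε T h u →
      IsAlternatingTwist ε (T.addRight ε) (h + u) u
  | addLeft {T : TangleDiagram} {h u : ℕ} : 0 < u → IsAlternatingTwist ε T h u →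
      IsAlternatingTwist ε (T.addLeft ε) (h + u) u
  | mulBottom {T : TangleDiagram} {h u : ℕ} : 0 < h → IsAlternatingTwist ε T h u →
      IsAlternatingTwist ε (T.mulBottom ε) h (u + h)
  | mulTop {T : TangleDiagram} {h u : ℕ} : 0 < h → IsAlternatingTwist ε T h u →
      IsAlternatingTwist ε (T.mulTop ε) h (u + h)

/-- Is the strand of the tangle `[+1]` (for `ε = true`) or `[-1]` (for `ε = false`) that ends at
the corner `i` the overcrossing one? -/
def OverAt (ε : Bool) : Corner → Prop
  | .nw => ε = true
  | .se => ε = true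
  | .ne => ε = false
  | .sw => ε = false

/-- Each end of the tangle is a strand leaving a crossing, over or under as for `[±1]`. -/
def TipsLike (T : TangleDiagram) (ε : Bool) : Prop :=
  ∀ i, ∃ c k, T.corner c k = T.tip i ∧ (T.IsOver c k ↔ OverAt ε i)

theorem Alternating.of_attach {ε : Bool} {newCorner newTip : Corner → T.Edge ⊕ Bool}
    (h : (T.attach ε newCorner newTip).Alternating) : T.Alternating := by
  intro c i c' i' hne heq
  refine h (some c) i (some c') i' (fun h' => hne ?_) (congrArg Sum.inl heq)
  obtain ⟨h1, rfl⟩ := Prod.mk.inj h'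
  exact congrArg (·, i) (Option.some.inj h1)

/-- The glued edge must change between over and under. The end it leaves behaves like corner `j` of
a crossing of type `ε`, opposite to corner `i` of that type, so the new crossing can only have type
`ε`. -/
theorem TipsLike.attach_eq {ε ε' : Bool} (ht : T.TipsLike ε)
    {newCorner newTip : Corner → T.Edge ⊕ Bool}
    (h : (T.attach ε' newCorner newTip).Alternating) (i j : Corner)
    (hij : newCorner i = .inl (T.tip j)) (ho : OverAt ε j ↔ ¬ OverAt ε i) : ε' = ε := by
  obtain ⟨c, k, hck, ho'⟩ := ht j
  have h1 := h none i (some c) k (fun h' => nomatch congrArg Prod.fst h')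
    (hij.trans (congrArg Sum.inl hck.symm))
  have h2 : (T.attach ε' newCorner newTip).IsOver (some c) k ↔ T.IsOver c k := by
    cases k <;> rfl
  have h3 : (T.attach ε' newCorner newTip).IsOver none i ↔ OverAt ε' i := by
    cases i <;> rfl
  rw [h2, h3, ho', ho, not_not] at h1
  revert h1
  cases i <;> cases ε <;> cases ε' <;> simp [OverAt]

theorem TipsLike.attach {ε : Bool} {newCorner newTip : Corner → T.Edge ⊕ Bool}
    (h : ∀ i, newTip i = newCorner i ∨ T.TipsLike ε ∧ newTip i = .inl (T.tip i)) :
    (T.attach ε newCorner newTip).TipsLike ε := by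
  intro i
  obtain h | ⟨ht, h⟩ := h i
  · exact ⟨none, i, h.symm, by cases i <;> rfl⟩
  · obtain ⟨c, k, hck, ho⟩ := ht i
    refine ⟨some c, k, (congrArg Sum.inl hck).trans h.symm, Iff.trans ?_ ho⟩
    cases k <;> rfl

/-- Alternation and the absence of nugatory crossings both pass to the subtangle, which permits
induction. `TipsLike` is carried along because it is what fixes the sign of the next crossing. -/
theorem isAlternatingTwist_of_isTwistForm (hT : T.IsTwistForm) (hAlt : T.Alternating)
    (hnug : ∀ c, ¬ T.IsNugatoryCrossing c) :
    T = zero ∨ T = infty ∨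
      ∃ ε h u, 0 < h ∧ 0 < u ∧ T.IsAlternatingTwist ε h u ∧ T.TipsLike ε := by
  induction hT with
  | zero => exact .inl rfl
  | infty => exact .inr (.inl rfl)
  | addRight T ε hT ih =>
    refine .inr (.inr ?_)
    obtain rfl | rfl | ⟨ε', h, u, hh, hu, hTw, ht⟩ := ih (Alternating.of_attach hAlt) fun c hc =>
      hnug (some c) (hc.attach ε (by rintro (_ | _ | _ | _) <;> simp)
        (by rintro (_ | _ | _ | _) <;> simp))
    -- The first crossing may have either sign, and all four ends leave it.
    · exact ⟨ε, _, _, Nat.one_pos, Nat.one_pos, .addRight Nat.one_pos .zero,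
        TipsLike.attach (by rintro (_ | _ | _ | _) <;> exact .inl rfl)⟩
    · exact (hnug none (isNugatoryCrossing_infty_addRight ε)).elim
    · obtain rfl := ht.attach_eq hAlt .nw .ne rfl (by simp [OverAt])
      exact ⟨ε, _, _, by omega, hu, .addRight hu hTw, TipsLike.attach
        (by rintro (_ | _ | _ | _) <;> first | exact .inl rfl | exact .inr ⟨ht, rfl⟩)⟩
  | addLeft T ε hT ih =>
    refine .inr (.inr ?_)
    obtain rfl | rfl | ⟨ε', h, u, hh, hu, hTw, ht⟩ := ih (Alternating.of_attach hAlt) fun c hc =>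
      hnug (some c) (hc.attach ε (by rintro (_ | _ | _ | _) <;> simp)
        (by rintro (_ | _ | _ | _) <;> simp))
    · exact ⟨ε, _, _, Nat.one_pos, Nat.one_pos, .addLeft Nat.one_pos .zero,
        TipsLike.attach (by rintro (_ | _ | _ | _) <;> exact .inl rfl)⟩
    · exact (hnug none (isNugatoryCrossing_infty_addLeft ε)).elim
    · obtain rfl := ht.attach_eq hAlt .ne .nw rfl (by simp [OverAt])
      exact ⟨ε, _, _, by omega, hu, .addLeft hu hTw, TipsLike.attach
        (by rintro (_ | _ | _ | _) <;> first | exact .inl rfl | exact .inr ⟨ht, rfl⟩)⟩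
  | mulBottom T ε hT ih =>
    refine .inr (.inr ?_)
    obtain rfl | rfl | ⟨ε', h, u, hh, hu, hTw, ht⟩ := ih (Alternating.of_attach hAlt) fun c hc =>
      hnug (some c) (hc.attach ε (by rintro (_ | _ | _ | _) <;> simp)
        (by rintro (_ | _ | _ | _) <;> simp))
    · exact (hnug none (isNugatoryCrossing_zero_mulBottom ε)).elim
    · exact ⟨ε, _, _, Nat.one_pos, Nat.one_pos, .mulBottom Nat.one_pos .infty,
        TipsLike.attach (by rintro (_ | _ | _ | _) <;> exact .inl rfl)⟩
    · obtain rfl := ht.attach_eq hAlt .nw .sw rfl (by simp [OverAt])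
      exact ⟨ε, _, _, hh, by omega, .mulBottom hh hTw, TipsLike.attach
        (by rintro (_ | _ | _ | _) <;> first | exact .inl rfl | exact .inr ⟨ht, rfl⟩)⟩
  | mulTop T ε hT ih =>
    refine .inr (.inr ?_)
    obtain rfl | rfl | ⟨ε', h, u, hh, hu, hTw, ht⟩ := ih (Alternating.of_attach hAlt) fun c hc =>
      hnug (some c) (hc.attach ε (by rintro (_ | _ | _ | _) <;> simp)
        (by rintro (_ | _ | _ | _) <;> simp))
    · exact (hnug none (isNugatoryCrossing_zero_mulTop ε)).elim
    · exact ⟨ε, _, _, Nat.one_pos, Nat.one_pos, .mulTop Nat.one_pos .infty,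
        TipsLike.attach (by rintro (_ | _ | _ | _) <;> exact .inl rfl)⟩
    · obtain rfl := ht.attach_eq hAlt .sw .nw rfl (by simp [OverAt])
      exact ⟨ε, _, _, hh, by omega, .mulTop hh hTw, TipsLike.attach
        (by rintro (_ | _ | _ | _) <;> first | exact .inl rfl | exact .inr ⟨ht, rfl⟩)⟩

theorem exists_isAlternatingTwist (hT : T.IsTwistForm) (hAlt : T.Alternating)
    (hnug : ∀ c, ¬ T.IsNugatoryCrossing c) : ∃ ε h u, T.IsAlternatingTwist ε h u := by
  obtain rfl | rfl | ⟨ε, h, u, -, -, hTw, -⟩ := isAlternatingTwist_of_isTwistForm hT hAlt hnug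
  -- Without crossings the sign is arbitrary; `true` is a dummy choice.
  exacts [⟨true, _, _, .zero⟩, ⟨true, _, _, .infty⟩, ⟨ε, h, u, hTw⟩]

/-! ### The basic integral coloring and its growth under an added crossing. -/

/-- An integral coloring `κ` of the edges of `T` that determines all other colorings, with lowest
color `m` and highest color `m + h + u`, taken at two opposite ends. -/
structure IsBasicColoring (T : TangleDiagram) (ε : Bool) (h u : ℕ) (κ : T.Edge → ℤ) (m : ℤ) :
    Prop where
  nw : κ (T.tip .nw) = m + bif ε then (u : ℤ) else 0
  ne : κ (T.tip .ne) = m + h + bif ε then (u : ℤ) else 0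
  sw : κ (T.tip .sw) = m + bif ε then 0 else (u : ℤ)
  se : κ (T.tip .se) = m + h + bif ε then 0 else (u : ℤ)
  lower : ∀ e, m ≤ κ e
  upper : ∀ e, κ e ≤ m + h + u
  arc_eq : ∀ e f, κ e = κ f → (Quot.mk _ e : T.Arc) = Quot.mk _ f
  ncard : (Set.range κ).ncard = T.numCrossings + 2
  affine : ∀ {R : Type} [CommRing R] (g : T.Edge → R), T.IsEdgeColoring g →
    ∃ x y : R, ∀ e, g e = x + κ e * y

/-- The bookkeeping common to the four operations. The overcrossing strand runs from the end `j` of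
`T` through corners `i` and `k` into the new edge `!b`, so that edge brings no new arc. Only the
edge `b` does, and `hb` puts its color outside the old interval. -/
theorem IsBasicColoring.attach {ε : Bool} {h u : ℕ} {κ : T.Edge → ℤ} {m : ℤ}
    (hκ : T.IsBasicColoring ε h u κ m) {newCorner newTip : Corner → T.Edge ⊕ Bool}
    {h' u' : ℕ} {m' : ℤ} (v : Bool → ℤ) (b : Bool) (i j k : Corner)
    (hi : newCorner i = .inl (T.tip j)) (hk : newCorner k = .inr (!b))
    (hio : OverAt ε i) (hko : OverAt ε k) (hv : v (!b) = κ (T.tip j))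
    (hb : v b < m ∨ m + h + u < v b) (hm : m' ≤ m) (hM : m + h + u ≤ m' + h' + u')
    (hbm : m' ≤ v b) (hbM : v b ≤ m' + h' + u')
    (nw : Sum.elim κ v (newTip .nw) = m' + bif ε then (u' : ℤ) else 0)
    (ne : Sum.elim κ v (newTip .ne) = m' + h' + bif ε then (u' : ℤ) else 0)
    (sw : Sum.elim κ v (newTip .sw) = m' + bif ε then 0 else (u' : ℤ))
    (se : Sum.elim κ v (newTip .se) = m' + h' + bif ε then 0 else (u' : ℤ))
    (haff : ∀ {R : Type} [CommRing R] (g : T.Edge ⊕ Bool → R) (x y : R),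
      (T.attach ε newCorner newTip).IsEdgeColoring g → (∀ e, g (.inl e) = x + κ e * y) →
      ∀ b, g (.inr b) = x + v b * y) :
    (T.attach ε newCorner newTip).IsBasicColoring ε h' u' (Sum.elim κ v) m' := by
  have hlo := hκ.lower
  have hup := hκ.upper
  have hcases : ∀ b', b' = b ∨ b' = !b := by intro b'; cases b <;> cases b' <;> simp
  have hold : (Quot.mk _ (.inr (!b)) : (T.attach ε newCorner newTip).Arc) =
      Quot.mk _ (.inl (T.tip j)) := by
    refine Quot.sound ⟨none, k, i, ⟨?_, ?_⟩, hk, hi⟩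
    · cases k <;> exact hko
    · cases i <;> exact hio
  have hinl : ∀ e f, κ e = κ f →
      (Quot.mk _ (.inl e) : (T.attach ε newCorner newTip).Arc) = Quot.mk _ (.inl f) := by
    intro e f hef
    refine congrArg (Quot.map Sum.inl ?_) (hκ.arc_eq e f hef)
    rintro _ _ ⟨c, i, k, ⟨h1, h2⟩, rfl, rfl⟩
    refine ⟨some c, i, k, ⟨?_, ?_⟩, rfl, rfl⟩
    · cases i <;> exact h1
    · cases k <;> exact h2
  have hne : ∀ e, κ e ≠ v b := by
    intro e he
    have := hlo e
    have := hup e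
    omega
  -- Up to arc and color, `b` is the only edge not already in `T`.
  have hred : ∀ e : T.Edge ⊕ Bool, e = .inr b ∨ ∃ e' : T.Edge,
      Sum.elim κ v e = κ e' ∧ (Quot.mk _ e : (T.attach ε newCorner newTip).Arc) =
        Quot.mk _ (.inl e') := by
    rintro (e | b')
    · exact .inr ⟨e, rfl, rfl⟩
    · obtain rfl | rfl := hcases b'
      · exact .inl rfl
      · exact .inr ⟨_, hv, hold⟩
  have hrange : Set.range (Sum.elim κ v) = insert (v b) (Set.range κ) := by
    ext z
    constructor
    · rintro ⟨e, rfl⟩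
      obtain rfl | ⟨e', he', -⟩ := hred e
      · exact .inl rfl
      · exact .inr ⟨e', he'.symm⟩
    · rintro (rfl | ⟨e, rfl⟩)
      · exact ⟨.inr b, rfl⟩
      · exact ⟨.inl e, rfl⟩
  refine ⟨nw, ne, sw, se, ?_, ?_, ?_, ?_, ?_⟩
  · intro e
    obtain rfl | ⟨e', he', -⟩ := hred e
    · exact hbm
    · exact he' ▸ hm.trans (hlo e')
  · intro e
    obtain rfl | ⟨e', he', -⟩ := hred e
    · exact hbM
    · exact he' ▸ (hup e').trans hM
  · intro e f hef
    obtain rfl | ⟨e', he', hea⟩ := hred e <;> obtain rfl | ⟨f', hf', hfa⟩ := hred f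
    · rfl
    · exact (hne f' (hf'.symm.trans hef.symm)).elim
    · exact (hne e' (he'.symm.trans hef)).elim
    · exact hea.trans ((hinl e' f' (he'.symm.trans (hef.trans hf'))).trans hfa.symm)
  · have hcard : (T.attach ε newCorner newTip).numCrossings = T.numCrossings + 1 :=
      Fintype.card_option
    have := Set.ncard_insert_of_notMem (a := v b) (s := Set.range κ)
      (by rintro ⟨e, he⟩; exact hne e he) (Set.finite_range κ)
    rw [hκ.ncard] at this
    rw [hcard]
    exact (congrArg Set.ncard hrange).trans (by omega)
  · intro R _ g hg
    obtain ⟨x, y, hxy⟩ := hκ.affine (fun e => g (.inl e)) fun c => hg (some c)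
    refine ⟨x, y, ?_⟩
    rintro (e | b')
    · exact hxy e
    · exact haff g x y hg hxy b'

theorem IsBasicColoring.zero (ε : Bool) :
    zero.IsBasicColoring ε 0 1 (fun e : Bool => bif e == ε then 1 else 0) 0 := by
  refine ⟨?_, ?_, ?_, ?_, ?_, ?_, ?_, ?_, ?_⟩
  · cases ε <;> rfl
  · cases ε <;> rfl
  · cases ε <;> rfl
  · cases ε <;> rfl
  · rintro (_ | _) <;> cases ε <;> simp
  · rintro (_ | _) <;> cases ε <;> simp
  · rintro (_ | _) (_ | _) <;> cases ε <;> simp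
  · have : Set.range (fun e : Bool => (bif e == ε then 1 else 0 : ℤ)) = {0, 1} := by
      ext z; cases ε <;> simp [or_comm]
    exact (congrArg Set.ncard this).trans (Set.ncard_pair zero_ne_one)
  · intro R _ g _
    refine ⟨g !ε, g ε - g !ε, ?_⟩
    rintro (_ | _) <;> cases ε <;> simp

theorem IsBasicColoring.infty (ε : Bool) :
    infty.IsBasicColoring ε 1 0 (fun e : Bool => bif e then 0 else 1) 0 := by
  refine ⟨?_, ?_, ?_, ?_, ?_, ?_, ?_, ?_, ?_⟩
  · cases ε <;> rfl
  · cases ε <;> rfl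
  · cases ε <;> rfl
  · cases ε <;> rfl
  · rintro (_ | _) <;> simp
  · rintro (_ | _) <;> simp
  · rintro (_ | _) (_ | _) <;> simp
  · have : Set.range (fun e : Bool => (bif e then 0 else 1 : ℤ)) = {0, 1} := by
      ext z; simp [or_comm]
    exact (congrArg Set.ncard this).trans (Set.ncard_pair zero_ne_one)
  · intro R _ g _
    refine ⟨g true, g false - g true, ?_⟩
    rintro (_ | _) <;> simp

/-- The overcrossing strand carries the highest color `m + h + u`; reflecting the other right end
color `m + h` in it gives `m + h + 2u`, which is new since `0 < u`. -/
theorem IsBasicColoring.addRight {ε : Bool} {h u : ℕ} {κ : T.Edge → ℤ} {m : ℤ}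
    (hκ : T.IsBasicColoring ε h u κ m) (hu : 0 < u) :
    (T.addRight ε).IsBasicColoring ε (h + u) u
      (Sum.elim κ fun b => m + h + u + bif b == ε then (u : ℤ) else 0) (m) := by
  have ⟨h1, h2, h3, h4, _, _, _, _, _⟩ := hκ
  cases ε <;> simp only [cond_true, cond_false] at h1 h2 h3 h4
  · refine hκ.attach _ false .sw .se .ne rfl rfl rfl rfl ?_ ?_ ?_ ?_ ?_ ?_ ?_ ?_ ?_ ?_ ?_
    any_goals (simp <;> omega)
    intro R _ g x y hg hxy
    have e1 : g (.inr true) = g (.inl (T.tip .se)) := ((hg none).2 rfl).1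
    have e2 : g (.inl (T.tip .ne)) + g (.inr false) = 2 * g (.inr true) :=
      ((hg none).2 rfl).2
    have e3 := hxy (T.tip .se)
    have e4 := hxy (T.tip .ne)
    rw [h4] at e3
    rw [h2] at e4
    push_cast at e3 e4
    rintro (_ | _) <;> simp
    · linear_combination e2 - e4 + 2 * e3 + 2 * e1
    · linear_combination e3 + e1
  · refine hκ.attach _ true .nw .ne .se rfl rfl rfl rfl ?_ ?_ ?_ ?_ ?_ ?_ ?_ ?_ ?_ ?_ ?_
    any_goals (simp <;> omega)
    intro R _ g x y hg hxy
    have e1 : g (.inl (T.tip .ne)) = g (.inr false) := ((hg none).1 rfl).1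
    have e2 : g (.inr true) + g (.inl (T.tip .se)) = 2 * g (.inl (T.tip .ne)) :=
      ((hg none).1 rfl).2
    have e3 := hxy (T.tip .ne)
    have e4 := hxy (T.tip .se)
    rw [h2] at e3
    rw [h4] at e4
    push_cast at e3 e4
    rintro (_ | _) <;> simp
    · linear_combination e3 - e1
    · linear_combination e2 - e4 + 2 * e3

/-- The reflection is now in the lowest color `m`, which pushes the lower bound down to `m - u`. -/
theorem IsBasicColoring.addLeft {ε : Bool} {h u : ℕ} {κ : T.Edge → ℤ} {m : ℤ}
    (hκ : T.IsBasicColoring ε h u κ m) (hu : 0 < u) :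
    (T.addLeft ε).IsBasicColoring ε (h + u) u
      (Sum.elim κ fun b => m - bif b == ε then 0 else (u : ℤ)) (m - u) := by
  have ⟨h1, h2, h3, h4, _, _, _, _, _⟩ := hκ
  cases ε <;> simp only [cond_true, cond_false] at h1 h2 h3 h4
  · refine hκ.attach _ true .ne .nw .sw rfl rfl rfl rfl ?_ ?_ ?_ ?_ ?_ ?_ ?_ ?_ ?_ ?_ ?_
    any_goals (simp <;> omega)
    intro R _ g x y hg hxy
    have e1 : g (.inl (T.tip .nw)) = g (.inr false) := ((hg none).2 rfl).1
    have e2 : g (.inr true) + g (.inl (T.tip .sw)) = 2 * g (.inl (T.tip .nw)) :=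
      ((hg none).2 rfl).2
    have e3 := hxy (T.tip .nw)
    have e4 := hxy (T.tip .sw)
    rw [h1] at e3
    rw [h3] at e4
    push_cast at e3 e4
    rintro (_ | _) <;> simp
    · linear_combination e3 - e1
    · linear_combination e2 - e4 + 2 * e3
  · refine hκ.attach _ false .se .sw .nw rfl rfl rfl rfl ?_ ?_ ?_ ?_ ?_ ?_ ?_ ?_ ?_ ?_ ?_
    any_goals (simp <;> omega)
    intro R _ g x y hg hxy
    have e1 : g (.inr true) = g (.inl (T.tip .sw)) := ((hg none).1 rfl).1
    have e2 : g (.inl (T.tip .nw)) + g (.inr false) = 2 * g (.inr true) :=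
      ((hg none).1 rfl).2
    have e3 := hxy (T.tip .sw)
    have e4 := hxy (T.tip .nw)
    rw [h3] at e3
    rw [h1] at e4
    push_cast at e3 e4
    rintro (_ | _) <;> simp
    · linear_combination e2 - e4 + 2 * e3 + 2 * e1
    · linear_combination e3 + e1

/-- The sign decides which extreme color is at the bottom, and hence whether the interval grows by
`h` downwards (`ε = true`) or upwards. At the top the two cases are exchanged. -/
theorem IsBasicColoring.mulBottom {ε : Bool} {h u : ℕ} {κ : T.Edge → ℤ} {m : ℤ}
    (hκ : T.IsBasicColoring ε h u κ m) (hh : 0 < h) :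
    (T.mulBottom ε).IsBasicColoring ε h (u + h)
      (Sum.elim κ fun b => bif ε then m - bif b then (h : ℤ) else 0
        else m + h + u + bif b then 0 else (h : ℤ)) (m - bif ε then (h : ℤ) else 0) := by
  have ⟨h1, h2, h3, h4, _, _, _, _, _⟩ := hκ
  cases ε <;> simp only [cond_true, cond_false] at h1 h2 h3 h4
  · refine hκ.attach _ false .ne .se .sw rfl rfl rfl rfl ?_ ?_ ?_ ?_ ?_ ?_ ?_ ?_ ?_ ?_ ?_
    any_goals (simp <;> omega)
    intro R _ g x y hg hxy
    have e1 : g (.inl (T.tip .se)) = g (.inr true) := ((hg none).2 rfl).1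
    have e2 : g (.inl (T.tip .sw)) + g (.inr false) = 2 * g (.inl (T.tip .se)) :=
      ((hg none).2 rfl).2
    have e3 := hxy (T.tip .se)
    have e4 := hxy (T.tip .sw)
    rw [h4] at e3
    rw [h3] at e4
    push_cast at e3 e4
    rintro (_ | _) <;> simp
    · linear_combination e2 - e4 + 2 * e3
    · linear_combination e3 - e1
  · refine hκ.attach _ true .nw .sw .se rfl rfl rfl rfl ?_ ?_ ?_ ?_ ?_ ?_ ?_ ?_ ?_ ?_ ?_
    any_goals (simp <;> omega)
    intro R _ g x y hg hxy
    have e1 : g (.inl (T.tip .sw)) = g (.inr false) := ((hg none).1 rfl).1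
    have e2 : g (.inl (T.tip .se)) + g (.inr true) = 2 * g (.inl (T.tip .sw)) :=
      ((hg none).1 rfl).2
    have e3 := hxy (T.tip .sw)
    have e4 := hxy (T.tip .se)
    rw [h3] at e3
    rw [h4] at e4
    push_cast at e3 e4
    rintro (_ | _) <;> simp
    · linear_combination e3 - e1
    · linear_combination e2 - e4 + 2 * e3

theorem IsBasicColoring.mulTop {ε : Bool} {h u : ℕ} {κ : T.Edge → ℤ} {m : ℤ}
    (hκ : T.IsBasicColoring ε h u κ m) (hh : 0 < h) :
    (T.mulTop ε).IsBasicColoring ε h (u + h)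
      (Sum.elim κ fun b => bif ε then m + h + u + bif b then 0 else (h : ℤ)
        else m - bif b then (h : ℤ) else 0) (m - bif ε then 0 else (h : ℤ)) := by
  have ⟨h1, h2, h3, h4, _, _, _, _, _⟩ := hκ
  cases ε <;> simp only [cond_true, cond_false] at h1 h2 h3 h4
  · refine hκ.attach _ true .sw .nw .ne rfl rfl rfl rfl ?_ ?_ ?_ ?_ ?_ ?_ ?_ ?_ ?_ ?_ ?_
    any_goals (simp <;> omega)
    intro R _ g x y hg hxy
    have e1 : g (.inr false) = g (.inl (T.tip .nw)) := ((hg none).2 rfl).1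
    have e2 : g (.inr true) + g (.inl (T.tip .ne)) = 2 * g (.inr false) :=
      ((hg none).2 rfl).2
    have e3 := hxy (T.tip .nw)
    have e4 := hxy (T.tip .ne)
    rw [h1] at e3
    rw [h2] at e4
    push_cast at e3 e4
    rintro (_ | _) <;> simp
    · linear_combination e3 + e1
    · linear_combination e2 - e4 + 2 * e3 + 2 * e1
  · refine hκ.attach _ false .se .ne .nw rfl rfl rfl rfl ?_ ?_ ?_ ?_ ?_ ?_ ?_ ?_ ?_ ?_ ?_
    any_goals (simp <;> omega)
    intro R _ g x y hg hxy
    have e1 : g (.inr true) = g (.inl (T.tip .ne)) := ((hg none).1 rfl).1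
    have e2 : g (.inr false) + g (.inl (T.tip .nw)) = 2 * g (.inr true) :=
      ((hg none).1 rfl).2
    have e3 := hxy (T.tip .ne)
    have e4 := hxy (T.tip .nw)
    rw [h2] at e3
    rw [h1] at e4
    push_cast at e3 e4
    rintro (_ | _) <;> simp
    · linear_combination e2 - e4 + 2 * e3 + 2 * e1
    · linear_combination e3 + e1

end TangleDiagram

/-! ### The determinant of the numerator closure. -/

namespace Diagram

/-- At `A = √i` a closed curve has the value zero, so only the states with a single closed curve
contribute to the bracket. -/
theorem kauffmanBracket_sqrt_I (D : Diagram) [Nonempty D.Edge] :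
    open Classical in
    D.kauffmanBracket (Complex.exp (Real.pi * Complex.I / 4)) =
      ∑ s : D.Crossing → Smoothing,
        if Subsingleton (Quot (D.Joined fun c i k => (s c).Joins i k)) then
          ∏ c, D.smoothingWeight (Complex.exp (Real.pi * Complex.I / 4)) c (s c) else 0 := by
  classical
  have hA : (Complex.exp (Real.pi * Complex.I / 4)) ^ 2 = Complex.I := by
    rw [← Complex.exp_nat_mul]
    refine Eq.trans ?_ Complex.exp_pi_div_two_mul_I
    exact congrArg Complex.exp (by push_cast; ring)
  have hδ : -(Complex.exp (Real.pi * Complex.I / 4)) ^ 2 -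
      (Complex.exp (Real.pi * Complex.I / 4))⁻¹ ^ 2 = 0 := by
    rw [inv_pow, hA, Complex.inv_I]
    ring
  rw [kauffmanBracket, hδ]
  refine Finset.sum_congr rfl fun s _ => ?_
  -- A diagram with no edges would have no loops, and the truncated exponent `numLoops - 1` would be
  -- `0`, as for a single loop.
  have hne : Nonempty (Quot (D.Joined fun c i k => (s c).Joins i k)) :=
    Nonempty.map (Quot.mk _) inferInstance
  have hpos : 0 < D.numLoops s := Nat.card_pos
  split_ifs with hs
  · rw [show D.numLoops s = 1 from Nat.card_eq_one_iff_unique.2 ⟨hs, hne⟩]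
    simp
  · have h1 : D.numLoops s ≠ 1 := fun h => hs (Nat.card_eq_one_iff_unique.1 h).1
    rw [zero_pow (by omega), mul_zero]

end Diagram

namespace TangleDiagram

open Diagram

variable {T : TangleDiagram}

/-- Closing the tangle obtained by smoothing all crossings according to `s` leaves a single closed
curve; `t = .zero` stands for the numerator and `t = .infty` for the denominator closure. -/
def IsConnectedClosure (T : TangleDiagram) (s : T.Crossing → Smoothing) (t : Smoothing) : Prop :=
  ∀ f : T.Edge → Prop,
    (∀ c i k, (s c).Joins i k → f (T.corner c i) = f (T.corner c k)) →
    (∀ i k, t.Joins i k → f (T.tip i) = f (T.tip k)) → ∀ e e', f e = f e'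

theorem subsingleton_loops_numerator_iff (s : T.Crossing → Smoothing) :
    Subsingleton (Quot (T.numerator.Joined fun c i k => (s c).Joins i k)) ↔
      T.IsConnectedClosure s .zero := by
  constructor
  · intro h f hf ht e e'
    have h1 : ∀ a b : T.Edge, (a = T.tip .nw ∧ b = T.tip .ne) ∨
        (a = T.tip .sw ∧ b = T.tip .se) → f a = f b := by
      rintro _ _ (⟨rfl, rfl⟩ | ⟨rfl, rfl⟩)
      exacts [ht .nw .ne trivial, ht .sw .se trivial]
    exact congrArg (Quot.lift (Quot.lift f h1)
      (by rintro _ _ ⟨c, i, k, hJ, rfl, rfl⟩; exact hf c i k hJ))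
      (h.elim (Quot.mk _ (Quot.mk _ e)) (Quot.mk _ (Quot.mk _ e')))
  · intro h
    refine ⟨fun x y => ?_⟩
    induction x using Quot.ind with | mk a =>
    induction a using Quot.ind with | mk a =>
    induction y using Quot.ind with | mk b =>
    induction b using Quot.ind with | mk b =>
    refine ((h (fun e => Quot.mk _ (Quot.mk _ e) = Quot.mk _ (Quot.mk _ b)) ?_ ?_ a b).mpr rfl)
    · intro c i k hJ
      exact congrArg (· = _) (Quot.sound ⟨c, i, k, hJ, rfl, rfl⟩)
    · rintro (_ | _ | _ | _) (_ | _ | _ | _) hJ <;> first | exact hJ.elim | skip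
      · exact congrArg (Quot.mk _ · = _) (Quot.sound (.inl ⟨rfl, rfl⟩))
      · exact congrArg (Quot.mk _ · = _) (Quot.sound (.inr ⟨rfl, rfl⟩))

open Classical in
/-- The sum of the weights of the states with connected closure. -/
noncomputable def closureSum (T : TangleDiagram) (A : ℂ) (t : Smoothing) : ℂ :=
  ∑ s : T.Crossing → Smoothing,
    if T.IsConnectedClosure s t then ∏ c, T.smoothingWeight A c (s c) else 0

open Classical in
theorem determinant_numerator (T : TangleDiagram) :
    T.numerator.determinant = ‖T.closureSum (Complex.exp (Real.pi * Complex.I / 4)) .zero‖ := by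
  have : Nonempty T.numerator.Edge := ⟨Quot.mk _ (T.tip .nw)⟩
  rw [determinant, kauffmanBracket_sqrt_I, closureSum]
  refine congrArg norm ?_
  refine Finset.sum_congr rfl fun s _ => ?_
  exact if_congr (subsingleton_loops_numerator_iff s) rfl rfl

/-- The states are split by the smoothing of the new crossing; `P` is the condition that this
smoothing leaves on the state of `T`. -/
theorem closureSum_attach {ε : Bool} {newCorner newTip : Corner → T.Edge ⊕ Bool} {A : ℂ}
    {t : Smoothing} (P : Smoothing → (T.Crossing → Smoothing) → Prop)
    (h : ∀ s, (T.attach ε newCorner newTip).IsConnectedClosure s t ↔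
      P (s none) fun c => s (some c)) :
    open Classical in
    (T.attach ε newCorner newTip).closureSum A t =
      (bif ε then A else A⁻¹) *
        (∑ s, if P .zero s then ∏ c, T.smoothingWeight A c (s c) else 0) +
      (bif ε then A⁻¹ else A) *
        (∑ s, if P .infty s then ∏ c, T.smoothingWeight A c (s c) else 0) := by
  classical
  have key : (T.attach ε newCorner newTip).closureSum A t =
      ∑ q : Smoothing × (T.Crossing → Smoothing), if P q.1 q.2 then
        (T.attach ε newCorner newTip).smoothingWeight A none q.1 *
          ∏ c, T.smoothingWeight A c (q.2 c) else 0 := by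
    refine Finset.sum_equiv (Equiv.piOptionEquivProd (β := fun _ => Smoothing))
      (fun _ => iff_of_true (Finset.mem_univ _) (Finset.mem_univ _)) fun s _ => ?_
    refine if_congr (h s) ?_ rfl
    exact Fintype.prod_option (fun c => (T.attach ε newCorner newTip).smoothingWeight A c (s c))
  rw [key, Fintype.sum_prod_type, Finset.mul_sum, Finset.mul_sum]
  have hs : (Finset.univ : Finset Smoothing) = {.zero, .infty} := rfl
  rw [hs, Finset.sum_pair (by decide)]
  congr 1
  · refine Finset.sum_congr rfl fun s _ => ?_
    cases ε <;> simp [smoothingWeight, attach]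
  · refine Finset.sum_congr rfl fun s _ => ?_
    cases ε <;> simp [smoothingWeight, attach]

theorem forall_joins_iff (t : Smoothing) (P : Corner → Corner → Prop) :
    (∀ i k, t.Joins i k → P i k) ↔
      match t with
      | .zero => P .nw .ne ∧ P .sw .se
      | .infty => P .nw .sw ∧ P .ne .se := by
  cases t
  · refine ⟨fun h => ⟨h _ _ trivial, h _ _ trivial⟩, fun h => ?_⟩
    rintro (_ | _ | _ | _) (_ | _ | _ | _) hJ <;> first | exact hJ.elim | exact h.1 | exact h.2
  · refine ⟨fun h => ⟨h _ _ trivial, h _ _ trivial⟩, fun h => ?_⟩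
    rintro (_ | _ | _ | _) (_ | _ | _ | _) hJ <;> first | exact hJ.elim | exact h.1 | exact h.2

theorem isConnectedClosure_attach_iff {ε : Bool} {newCorner newTip : Corner → T.Edge ⊕ Bool}
    (s : (T.attach ε newCorner newTip).Crossing → Smoothing) (t : Smoothing) :
    (T.attach ε newCorner newTip).IsConnectedClosure s t ↔
      ∀ (f : T.Edge → Prop) (a b : Prop),
        (∀ c i k, (s (some c)).Joins i k → f (T.corner c i) = f (T.corner c k)) →
        (∀ i k, (s none).Joins i k → Sum.elim f (fun x => bif x then a else b) (newCorner i) =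
          Sum.elim f (fun x => bif x then a else b) (newCorner k)) →
        (∀ i k, t.Joins i k → Sum.elim f (fun x => bif x then a else b) (newTip i) =
          Sum.elim f (fun x => bif x then a else b) (newTip k)) →
        (∀ e e', f e = f e') ∧ a = f (T.tip .nw) ∧ b = f (T.tip .nw) := by
  constructor
  · intro H f a b hc hn ht
    have key := H (Sum.elim f fun x => bif x then a else b)
      (by rintro (_ | c) i k hJ; exacts [hn i k hJ, hc c i k hJ]) ht
    exact ⟨fun e e' => key (.inl e) (.inl e'), key (.inr true) (.inl _),
      key (.inr false) (.inl _)⟩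
  · intro H f hc ht
    have hf : f = Sum.elim (fun e => f (.inl e))
        (fun x => bif x then f (.inr true) else f (.inr false)) := by
      funext x
      obtain e | _ | _ := x <;> rfl
    obtain ⟨h1, h2, h3⟩ := H (fun e => f (.inl e)) (f (.inr true)) (f (.inr false))
      (fun c i k hJ => hc (some c) i k hJ) (by rw [← hf]; exact hc none) (by rw [← hf]; exact ht)
    have key : ∀ e, f e = f (.inl (T.tip .nw)) := by
      rintro (e | _ | _)
      exacts [h1 _ _, h3, h2]
    exact fun e e' => (key e).trans (key e').symm

/-- A horizontal smoothing merely prolongs the right ends of `T`. A vertical one joins them to each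
other and also joins the two new ends: the numerator closure then becomes the denominator closure of
`T`, while the denominator closure splits off a circle. -/
theorem isConnectedClosure_addRight {ε : Bool} (s : (T.addRight ε).Crossing → Smoothing)
    (t : Smoothing) : (T.addRight ε).IsConnectedClosure s t ↔
      match s none, t with
      | .zero, t => T.IsConnectedClosure (fun c => s (some c)) t
      | .infty, .zero => T.IsConnectedClosure (fun c => s (some c)) .infty
      | .infty, .infty => False := by
  refine (isConnectedClosure_attach_iff s t).trans ?_
  simp only [IsConnectedClosure, forall_joins_iff]
  cases hs : s none <;> cases t <;> simp only [Sum.elim_inl, Sum.elim_inr, cond_true, cond_false]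
  · refine ⟨fun H f hc ht => (H f (f (T.tip .ne)) (f (T.tip .se)) hc (by grind) (by grind)).1,
      fun H f a b hc h1 h2 => ?_⟩
    have key := H f hc (by grind)
    have e1 := key (T.tip .nw) (T.tip .ne)
    have e2 := key (T.tip .nw) (T.tip .sw)
    have e3 := key (T.tip .nw) (T.tip .se)
    exact ⟨key, by grind, by grind⟩
  · refine ⟨fun H f hc ht => (H f (f (T.tip .ne)) (f (T.tip .se)) hc (by grind) (by grind)).1,
      fun H f a b hc h1 h2 => ?_⟩
    have key := H f hc (by grind)
    have e1 := key (T.tip .nw) (T.tip .ne)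
    have e2 := key (T.tip .nw) (T.tip .sw)
    have e3 := key (T.tip .nw) (T.tip .se)
    exact ⟨key, by grind, by grind⟩
  · refine ⟨fun H f hc ht => (H f (f (T.tip .nw)) (f (T.tip .sw)) hc (by grind) (by grind)).1,
      fun H f a b hc h1 h2 => ?_⟩
    have key := H f hc (by grind)
    have e1 := key (T.tip .nw) (T.tip .ne)
    have e2 := key (T.tip .nw) (T.tip .sw)
    have e3 := key (T.tip .nw) (T.tip .se)
    exact ⟨key, by grind, by grind⟩
  -- The two new edges form the separate circle, so they may take a value different from that on
  -- `T`.
  · exact ⟨fun H => (H (fun _ => True) False False (by grind) (by grind)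
      (by grind)).2.1.mpr trivial, False.elim⟩

theorem isConnectedClosure_addLeft {ε : Bool} (s : (T.addLeft ε).Crossing → Smoothing)
    (t : Smoothing) : (T.addLeft ε).IsConnectedClosure s t ↔
      match s none, t with
      | .zero, t => T.IsConnectedClosure (fun c => s (some c)) t
      | .infty, .zero => T.IsConnectedClosure (fun c => s (some c)) .infty
      | .infty, .infty => False := by
  refine (isConnectedClosure_attach_iff s t).trans ?_
  simp only [IsConnectedClosure, forall_joins_iff]
  cases hs : s none <;> cases t <;> simp only [Sum.elim_inl, Sum.elim_inr, cond_true, cond_false]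
  · refine ⟨fun H f hc ht => (H f (f (T.tip .nw)) (f (T.tip .sw)) hc (by grind) (by grind)).1,
      fun H f a b hc h1 h2 => ?_⟩
    have key := H f hc (by grind)
    have e1 := key (T.tip .nw) (T.tip .ne)
    have e2 := key (T.tip .nw) (T.tip .sw)
    have e3 := key (T.tip .nw) (T.tip .se)
    exact ⟨key, by grind, by grind⟩
  · refine ⟨fun H f hc ht => (H f (f (T.tip .nw)) (f (T.tip .sw)) hc (by grind) (by grind)).1,
      fun H f a b hc h1 h2 => ?_⟩
    have key := H f hc (by grind)
    have e1 := key (T.tip .nw) (T.tip .ne)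
    have e2 := key (T.tip .nw) (T.tip .sw)
    have e3 := key (T.tip .nw) (T.tip .se)
    exact ⟨key, by grind, by grind⟩
  · refine ⟨fun H f hc ht => (H f (f (T.tip .ne)) (f (T.tip .se)) hc (by grind) (by grind)).1,
      fun H f a b hc h1 h2 => ?_⟩
    have key := H f hc (by grind)
    have e1 := key (T.tip .nw) (T.tip .ne)
    have e2 := key (T.tip .nw) (T.tip .sw)
    have e3 := key (T.tip .nw) (T.tip .se)
    exact ⟨key, by grind, by grind⟩
  · exact ⟨fun H => (H (fun _ => True) False False (by grind) (by grind)
      (by grind)).2.1.mpr trivial, False.elim⟩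

theorem isConnectedClosure_mulBottom {ε : Bool} (s : (T.mulBottom ε).Crossing → Smoothing)
    (t : Smoothing) : (T.mulBottom ε).IsConnectedClosure s t ↔
      match s none, t with
      | .infty, t => T.IsConnectedClosure (fun c => s (some c)) t
      | .zero, .infty => T.IsConnectedClosure (fun c => s (some c)) .zero
      | .zero, .zero => False := by
  refine (isConnectedClosure_attach_iff s t).trans ?_
  simp only [IsConnectedClosure, forall_joins_iff]
  cases hs : s none <;> cases t <;> simp only [Sum.elim_inl, Sum.elim_inr, cond_true, cond_false]
  · exact ⟨fun H => (H (fun _ => True) False False (by grind) (by grind)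
      (by grind)).2.1.mpr trivial, False.elim⟩
  · refine ⟨fun H f hc ht => (H f (f (T.tip .nw)) (f (T.tip .ne)) hc (by grind) (by grind)).1,
      fun H f a b hc h1 h2 => ?_⟩
    have key := H f hc (by grind)
    have e1 := key (T.tip .nw) (T.tip .ne)
    have e2 := key (T.tip .nw) (T.tip .sw)
    have e3 := key (T.tip .nw) (T.tip .se)
    exact ⟨key, by grind, by grind⟩
  · refine ⟨fun H f hc ht => (H f (f (T.tip .sw)) (f (T.tip .se)) hc (by grind) (by grind)).1,
      fun H f a b hc h1 h2 => ?_⟩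
    have key := H f hc (by grind)
    have e1 := key (T.tip .nw) (T.tip .ne)
    have e2 := key (T.tip .nw) (T.tip .sw)
    have e3 := key (T.tip .nw) (T.tip .se)
    exact ⟨key, by grind, by grind⟩
  · refine ⟨fun H f hc ht => (H f (f (T.tip .sw)) (f (T.tip .se)) hc (by grind) (by grind)).1,
      fun H f a b hc h1 h2 => ?_⟩
    have key := H f hc (by grind)
    have e1 := key (T.tip .nw) (T.tip .ne)
    have e2 := key (T.tip .nw) (T.tip .sw)
    have e3 := key (T.tip .nw) (T.tip .se)
    exact ⟨key, by grind, by grind⟩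

theorem isConnectedClosure_mulTop {ε : Bool} (s : (T.mulTop ε).Crossing → Smoothing)
    (t : Smoothing) : (T.mulTop ε).IsConnectedClosure s t ↔
      match s none, t with
      | .infty, t => T.IsConnectedClosure (fun c => s (some c)) t
      | .zero, .infty => T.IsConnectedClosure (fun c => s (some c)) .zero
      | .zero, .zero => False := by
  refine (isConnectedClosure_attach_iff s t).trans ?_
  simp only [IsConnectedClosure, forall_joins_iff]
  cases hs : s none <;> cases t <;> simp only [Sum.elim_inl, Sum.elim_inr, cond_true, cond_false]
  · exact ⟨fun H => (H (fun _ => True) False False (by grind) (by grind)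
      (by grind)).2.1.mpr trivial, False.elim⟩
  · refine ⟨fun H f hc ht => (H f (f (T.tip .sw)) (f (T.tip .se)) hc (by grind) (by grind)).1,
      fun H f a b hc h1 h2 => ?_⟩
    have key := H f hc (by grind)
    have e1 := key (T.tip .nw) (T.tip .ne)
    have e2 := key (T.tip .nw) (T.tip .sw)
    have e3 := key (T.tip .nw) (T.tip .se)
    exact ⟨key, by grind, by grind⟩
  · refine ⟨fun H f hc ht => (H f (f (T.tip .nw)) (f (T.tip .ne)) hc (by grind) (by grind)).1,
      fun H f a b hc h1 h2 => ?_⟩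
    have key := H f hc (by grind)
    have e1 := key (T.tip .nw) (T.tip .ne)
    have e2 := key (T.tip .nw) (T.tip .sw)
    have e3 := key (T.tip .nw) (T.tip .se)
    exact ⟨key, by grind, by grind⟩
  · refine ⟨fun H f hc ht => (H f (f (T.tip .nw)) (f (T.tip .ne)) hc (by grind) (by grind)).1,
      fun H f a b hc h1 h2 => ?_⟩
    have key := H f hc (by grind)
    have e1 := key (T.tip .nw) (T.tip .ne)
    have e2 := key (T.tip .nw) (T.tip .sw)
    have e3 := key (T.tip .nw) (T.tip .se)
    exact ⟨key, by grind, by grind⟩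

theorem closureSum_addRight (T : TangleDiagram) (ε : Bool) (A : ℂ) :
    (T.addRight ε).closureSum A .zero = (bif ε then A else A⁻¹) * T.closureSum A .zero +
        (bif ε then A⁻¹ else A) * T.closureSum A .infty ∧
      (T.addRight ε).closureSum A .infty = (bif ε then A else A⁻¹) * T.closureSum A .infty := by
  constructor
  · refine (closureSum_attach (fun x s => T.IsConnectedClosure s x) fun s =>
      (isConnectedClosure_addRight s .zero).trans (by cases s none <;> rfl)).trans ?_
    simp only [closureSum]
  · refine (closureSum_attach (fun x s => match x with
      | .zero => T.IsConnectedClosure s .infty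
      | .infty => False) fun s =>
      (isConnectedClosure_addRight s .infty).trans (by cases s none <;> rfl)).trans ?_
    simp only [closureSum, if_false, Finset.sum_const_zero, mul_zero, add_zero]

theorem closureSum_addLeft (T : TangleDiagram) (ε : Bool) (A : ℂ) :
    (T.addLeft ε).closureSum A .zero = (bif ε then A else A⁻¹) * T.closureSum A .zero +
        (bif ε then A⁻¹ else A) * T.closureSum A .infty ∧
      (T.addLeft ε).closureSum A .infty = (bif ε then A else A⁻¹) * T.closureSum A .infty := by
  constructor
  · refine (closureSum_attach (fun x s => T.IsConnectedClosure s x) fun s =>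
      (isConnectedClosure_addLeft s .zero).trans (by cases s none <;> rfl)).trans ?_
    simp only [closureSum]
  · refine (closureSum_attach (fun x s => match x with
      | .zero => T.IsConnectedClosure s .infty
      | .infty => False) fun s =>
      (isConnectedClosure_addLeft s .infty).trans (by cases s none <;> rfl)).trans ?_
    simp only [closureSum, if_false, Finset.sum_const_zero, mul_zero, add_zero]

theorem closureSum_mulBottom (T : TangleDiagram) (ε : Bool) (A : ℂ) :
    (T.mulBottom ε).closureSum A .infty = (bif ε then A⁻¹ else A) * T.closureSum A .infty +
        (bif ε then A else A⁻¹) * T.closureSum A .zero ∧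
      (T.mulBottom ε).closureSum A .zero = (bif ε then A⁻¹ else A) * T.closureSum A .zero := by
  constructor
  · refine (closureSum_attach (fun x s => T.IsConnectedClosure s x) fun s =>
      (isConnectedClosure_mulBottom s .infty).trans (by cases s none <;> rfl)).trans ?_
    simp only [closureSum]
    ring
  · refine (closureSum_attach (fun x s => match x with
      | .infty => T.IsConnectedClosure s .zero
      | .zero => False) fun s =>
      (isConnectedClosure_mulBottom s .zero).trans (by cases s none <;> rfl)).trans ?_
    simp only [closureSum, if_false, Finset.sum_const_zero, mul_zero, zero_add]

theorem closureSum_mulTop (T : TangleDiagram) (ε : Bool) (A : ℂ) :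
    (T.mulTop ε).closureSum A .infty = (bif ε then A⁻¹ else A) * T.closureSum A .infty +
        (bif ε then A else A⁻¹) * T.closureSum A .zero ∧
      (T.mulTop ε).closureSum A .zero = (bif ε then A⁻¹ else A) * T.closureSum A .zero := by
  constructor
  · refine (closureSum_attach (fun x s => T.IsConnectedClosure s x) fun s =>
      (isConnectedClosure_mulTop s .infty).trans (by cases s none <;> rfl)).trans ?_
    simp only [closureSum]
    ring
  · refine (closureSum_attach (fun x s => match x with
      | .infty => T.IsConnectedClosure s .zero
      | .zero => False) fun s =>
      (isConnectedClosure_mulTop s .zero).trans (by cases s none <;> rfl)).trans ?_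
    simp only [closureSum, if_false, Finset.sum_const_zero, mul_zero, zero_add]

theorem closureSum_zero (A : ℂ) :
    TangleDiagram.zero.closureSum A .zero = 0 ∧ TangleDiagram.zero.closureSum A .infty = 1 := by
  classical
  have : IsEmpty TangleDiagram.zero.Crossing := inferInstanceAs (IsEmpty Empty)
  have key : ∀ t, TangleDiagram.zero.closureSum A t = if t = .zero then 0 else 1 := by
    intro t
    refine (Fintype.sum_eq_single (fun c => nomatch c) fun s h => (h (funext nofun)).elim).trans ?_
    cases t
    · refine if_neg fun h => ?_
      have := h (fun e : Bool => e = true) nofun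
        (by rintro (_ | _ | _ | _) (_ | _ | _ | _) hJ <;> first | exact hJ.elim | rfl) true false
      exact Bool.false_ne_true (this.mp rfl)
    · refine (if_pos fun f _ ht => ?_).trans (Fintype.prod_empty _)
      have := ht .nw .sw trivial
      rintro (_ | _) (_ | _)
      exacts [rfl, this.symm, this, rfl]
  exact ⟨key .zero, key .infty⟩

theorem closureSum_infty (A : ℂ) :
    TangleDiagram.infty.closureSum A .zero = 1 ∧ TangleDiagram.infty.closureSum A .infty = 0 := by
  classical
  have : IsEmpty TangleDiagram.infty.Crossing := inferInstanceAs (IsEmpty Empty)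
  have key : ∀ t, TangleDiagram.infty.closureSum A t = if t = .zero then 1 else 0 := by
    intro t
    refine (Fintype.sum_eq_single (fun c => nomatch c) fun s h => (h (funext nofun)).elim).trans ?_
    cases t
    · refine (if_pos fun f _ ht => ?_).trans (Fintype.prod_empty _)
      have := ht .nw .ne trivial
      rintro (_ | _) (_ | _)
      exacts [rfl, this.symm, this, rfl]
    · refine if_neg fun h => ?_
      have := h (fun e : Bool => e = true) nofun
        (by rintro (_ | _ | _ | _) (_ | _ | _ | _) hJ <;> first | exact hJ.elim | rfl) true false
      exact Bool.false_ne_true (this.mp rfl)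
  exact ⟨key .zero, key .infty⟩

/-- Since all crossings have the same type, the ratio of phases of the two closure sums is always
`B⁻²`. This is exactly what makes the two terms of each recursion have equal phase, so their moduli
add as `h` and `u` do. -/
theorem IsAlternatingTwist.exists_closureSum {ε : Bool} {h u : ℕ}
    (hT : T.IsAlternatingTwist ε h u) {A B : ℂ} (hA : ‖A‖ = 1) (hB : B = bif ε then A else A⁻¹) :
    ∃ z : ℂ, ‖z‖ = 1 ∧ T.closureSum A .infty = z * u ∧
      T.closureSum A .zero = z * (B⁻¹ * B⁻¹) * h := by
  have hBn : ‖B‖ = 1 := by cases ε <;> simp [hB, hA]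
  have hB0 : B ≠ 0 := by rw [← norm_ne_zero_iff, hBn]; exact one_ne_zero
  have hB' : (bif ε then A⁻¹ else A) = B⁻¹ := by cases ε <;> simp [hB]
  induction hT with
  | zero => exact ⟨1, norm_one, by simp [closureSum_zero]⟩
  -- The denominator sum vanishes here, so `z` is dictated by the numerator sum `1 = z * B⁻²`.
  | infty => exact ⟨B * B, by simp [hBn], by simp [closureSum_infty], by
    rw [(closureSum_infty A).1]; field_simp; simp⟩
  | addRight hu hT ih =>
    obtain ⟨z, hz, h1, h2⟩ := ih
    obtain ⟨e1, e2⟩ := closureSum_addRight _ ε A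
    refine ⟨B * z, by simp [hBn, hz], ?_, ?_⟩
    · rw [e2, h1, ← hB]; ring
    · rw [e1, h1, h2, ← hB, hB']; push_cast; field_simp
  | addLeft hu hT ih =>
    obtain ⟨z, hz, h1, h2⟩ := ih
    obtain ⟨e1, e2⟩ := closureSum_addLeft _ ε A
    refine ⟨B * z, by simp [hBn, hz], ?_, ?_⟩
    · rw [e2, h1, ← hB]; ring
    · rw [e1, h1, h2, ← hB, hB']; push_cast; field_simp
  | mulBottom hh hT ih =>
    obtain ⟨z, hz, h1, h2⟩ := ih
    obtain ⟨e1, e2⟩ := closureSum_mulBottom _ ε A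
    refine ⟨B⁻¹ * z, by simp [hBn, hz], ?_, ?_⟩
    · rw [e1, h1, h2, ← hB, hB']; push_cast; field_simp
    · rw [e2, h2, hB']; ring
  | mulTop hh hT ih =>
    obtain ⟨z, hz, h1, h2⟩ := ih
    obtain ⟨e1, e2⟩ := closureSum_mulTop _ ε A
    refine ⟨B⁻¹ * z, by simp [hBn, hz], ?_, ?_⟩
    · rw [e1, h1, h2, ← hB, hB']; push_cast; field_simp
    · rw [e2, h2, hB']; ring

/-- The determinant of the numerator closure. -/
theorem IsAlternatingTwist.determinant_numerator {ε : Bool} {h u : ℕ}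
    (hT : T.IsAlternatingTwist ε h u) : T.numerator.determinant = h := by
  have hA : ‖Complex.exp (Real.pi * Complex.I / 4)‖ = 1 := by
    rw [show (Real.pi * Complex.I / 4 : ℂ) = ((Real.pi / 4 : ℝ) : ℂ) * Complex.I by
      push_cast; ring]
    exact Complex.norm_exp_ofReal_mul_I _
  obtain ⟨z, hz, -, h2⟩ := hT.exists_closureSum hA rfl
  rw [TangleDiagram.determinant_numerator, h2]
  cases ε <;> simp [hz, hA]

/-! ### Distinct colors on the tangle and on its closure. -/

theorem IsAlternatingTwist.exists_isBasicColoring {ε : Bool} {h u : ℕ}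
    (hT : T.IsAlternatingTwist ε h u) : ∃ κ m, T.IsBasicColoring ε h u κ m := by
  induction hT with
  | zero => exact ⟨_, _, .zero ε⟩
  | infty => exact ⟨_, _, .infty ε⟩
  | addRight hu _ ih => obtain ⟨κ, m, hκ⟩ := ih; exact ⟨_, _, hκ.addRight hu⟩
  | addLeft hu _ ih => obtain ⟨κ, m, hκ⟩ := ih; exact ⟨_, _, hκ.addLeft hu⟩
  | mulBottom hh _ ih => obtain ⟨κ, m, hκ⟩ := ih; exact ⟨_, _, hκ.mulBottom hh⟩
  | mulTop hh _ ih => obtain ⟨κ, m, hκ⟩ := ih; exact ⟨_, _, hκ.mulTop hh⟩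

theorem IsBasicColoring.injective_color {ε : Bool} {h u : ℕ} {κ : T.Edge → ℤ} {m : ℤ}
    (hκ : T.IsBasicColoring ε h u κ m) (C : T.toDiagram.Coloring ℤ) (hC : C.Nontrivial) :
    Function.Injective C.color := by
  obtain ⟨x, y, hxy⟩ := hκ.affine _ C.isEdgeColoring
  have hy : y ≠ 0 := by
    rintro rfl
    obtain ⟨a, b, hab⟩ := hC
    induction a using Quot.ind with | mk e =>
    induction b using Quot.ind with | mk f =>
    exact hab ((hxy e).trans (by simpa using (hxy f).symm))
  intro a b hab
  induction a using Quot.ind with | mk e =>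
  induction b using Quot.ind with | mk f =>
  have := (hxy e).symm.trans (hab.trans (hxy f))
  exact hκ.arc_eq e f (by simpa [hy] using this)

theorem numerator_arc_eq {e f : T.Edge} (h : (Quot.mk _ e : T.Arc) = Quot.mk _ f) :
    (Quot.mk _ (Quot.mk _ e) : T.numerator.Arc) = Quot.mk _ (Quot.mk _ f) := by
  refine congrArg (Quot.map (Quot.mk _) ?_) h
  rintro _ _ ⟨c, i, k, ⟨h1, h2⟩, rfl, rfl⟩
  refine ⟨c, i, k, ⟨?_, ?_⟩, rfl, rfl⟩
  · cases i <;> exact h1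
  · cases k <;> exact h2

/-- Suppose that all colors of a basic coloring, except the one at an end `j₂` that is joined to
another end `j₃`, lie between the colors `m₁` and `m₁ + h` of two joined ends `j₅` and `j₄`, where
`h` is a prime.  Then a nontrivial coloring of the numerator closure modulo `h` has distinct colors
on distinct arcs, as many as there are crossings. -/
theorem IsBasicColoring.numerator {ε : Bool} {h u : ℕ} {κ : T.Edge → ℤ} {m m₁ : ℤ}
    (hκ : T.IsBasicColoring ε h u κ m) (j₂ j₃ j₄ j₅ : Corner)
    (h23 : (Quot.mk _ (T.tip j₂) : T.numerator.Edge) = Quot.mk _ (T.tip j₃))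
    (h45 : (Quot.mk _ (T.tip j₄) : T.numerator.Edge) = Quot.mk _ (T.tip j₅))
    (h2 : κ (T.tip j₂) < m₁ ∨ m₁ + h < κ (T.tip j₂))
    (h3 : m₁ ≤ κ (T.tip j₃)) (h3' : κ (T.tip j₃) ≤ m₁ + h)
    (h4 : κ (T.tip j₄) = m₁ + h) (h5 : κ (T.tip j₅) = m₁)
    (hr : ∀ e, κ e = κ (T.tip j₂) ∨ m₁ ≤ κ e ∧ κ e ≤ m₁ + h) (hp : h.Prime)
    (C : T.numerator.Coloring (ZMod h)) (hC : C.Nontrivial) :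
    Function.Injective C.color ∧ (Set.range C.color).ncard = T.numerator.numCrossings := by
  have : Fact h.Prime := ⟨hp⟩
  have hpos := hp.pos
  obtain ⟨x, y, hxy⟩ := hκ.affine (fun e => C.color (Quot.mk _ (Quot.mk _ e)))
    fun c => C.isEdgeColoring c
  have hy : y ≠ 0 := by
    rintro rfl
    obtain ⟨a, b, hab⟩ := hC
    induction a using Quot.ind with | mk e =>
    induction e using Quot.ind with | mk e =>
    induction b using Quot.ind with | mk f =>
    induction f using Quot.ind with | mk f =>
    exact hab ((hxy e).trans (by simpa using (hxy f).symm))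
  -- As `h` is prime, `y` can be cancelled, and a half-open interval of length `h` has distinct
  -- residues.
  have hφ : ∀ k l : ℤ, m₁ ≤ k → k < m₁ + h → m₁ ≤ l → l < m₁ + h →
      x + k * y = x + l * y → k = l := by
    intro k l hk hk' hl hl' hkl
    have h1 : (k : ZMod h) = l := mul_right_cancel₀ hy (add_left_cancel hkl)
    have h2 : (h : ℤ) ∣ k - l := by
      rw [← ZMod.intCast_zmod_eq_zero_iff_dvd]
      push_cast
      rw [h1, sub_self]
    have := Int.eq_zero_of_abs_lt_dvd h2 (by rw [abs_lt]; omega)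
    omega
  -- Edges of the top color `m₁ + h` lie on the arc of `j₄`, which the closure joins to `j₅`, of
  -- color `m₁`.
  have hred' : ∀ e, m₁ ≤ κ e → κ e ≤ m₁ + h → ∃ e', m₁ ≤ κ e' ∧ κ e' < m₁ + h ∧
      (Quot.mk _ (Quot.mk _ e) : T.numerator.Arc) = Quot.mk _ (Quot.mk _ e') := by
    intro e he he'
    obtain he' | he' := he'.lt_or_eq
    · exact ⟨e, he, he', rfl⟩
    · exact ⟨T.tip j₅, h5.ge, by omega, (numerator_arc_eq (hκ.arc_eq _ _ (he'.trans h4.symm))).trans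
        (congrArg (Quot.mk _) h45)⟩
  have hred : ∀ e, ∃ e', m₁ ≤ κ e' ∧ κ e' < m₁ + h ∧
      (Quot.mk _ (Quot.mk _ e) : T.numerator.Arc) = Quot.mk _ (Quot.mk _ e') := by
    intro e
    obtain he | ⟨he, he'⟩ := hr e
    · obtain ⟨e', h1, h2, h3⟩ := hred' _ h3 h3'
      exact ⟨e', h1, h2, (numerator_arc_eq (hκ.arc_eq _ _ he)).trans
        ((congrArg (Quot.mk _) h23).trans h3)⟩
    · exact hred' e he he'
  refine ⟨?_, ?_⟩
  · intro a b hab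
    induction a using Quot.ind with | mk e =>
    induction e using Quot.ind with | mk e =>
    induction b using Quot.ind with | mk f =>
    induction f using Quot.ind with | mk f =>
    obtain ⟨e', he1, he2, he⟩ := hred e
    obtain ⟨f', hf1, hf2, hf⟩ := hred f
    rw [he, hf] at hab ⊢
    exact numerator_arc_eq (hκ.arc_eq _ _ (hφ _ _ he1 he2 hf1 hf2
      ((hxy e').symm.trans (hab.trans (hxy f')))))
  · have hS : ∀ k ∈ Set.range κ \ {κ (T.tip j₂), m₁ + h}, m₁ ≤ k ∧ k < m₁ + h := by
      rintro _ ⟨⟨e, rfl⟩, he⟩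
      simp only [Set.mem_insert_iff, Set.mem_singleton_iff, not_or] at he
      obtain h1 | ⟨h1, h2⟩ := hr e
      · exact (he.1 h1).elim
      · exact ⟨h1, lt_of_le_of_ne h2 he.2⟩
    have hrange : Set.range C.color =
        (fun k : ℤ => x + k * y) '' (Set.range κ \ {κ (T.tip j₂), m₁ + h}) := by
      ext z
      constructor
      · rintro ⟨a, rfl⟩
        induction a using Quot.ind with | mk e =>
        induction e using Quot.ind with | mk e =>
        obtain ⟨e', h1, h2, he⟩ := hred e
        refine ⟨κ e', ⟨⟨e', rfl⟩, ?_⟩, (hxy e').symm.trans (congrArg C.color he.symm)⟩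
        simp only [Set.mem_insert_iff, Set.mem_singleton_iff, not_or]
        omega
      · rintro ⟨_, ⟨⟨e, rfl⟩, -⟩, rfl⟩
        exact ⟨_, hxy e⟩
    -- Of the `v + 2` integral colors, the closure makes exactly these two redundant.
    have hsub : {κ (T.tip j₂), m₁ + h} ⊆ Set.range κ := by
      rintro _ (rfl | rfl)
      exacts [⟨_, rfl⟩, ⟨_, h4⟩]
    rw [hrange, Set.InjOn.ncard_image, Set.ncard_sdiff hsub (Set.toFinite _), hκ.ncard,
      Set.ncard_pair (by omega)]
    · rfl
    · intro k hk l hl hkl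
      exact hφ k l (hS k hk).1 (hS k hk).2 (hS l hl).1 (hS l hl).2 hkl

theorem numerator_edge_top (T : TangleDiagram) :
    (Quot.mk _ (T.tip .nw) : T.numerator.Edge) = Quot.mk _ (T.tip .ne) :=
  Quot.sound (.inl ⟨rfl, rfl⟩)

theorem numerator_edge_bottom (T : TangleDiagram) :
    (Quot.mk _ (T.tip .sw) : T.numerator.Edge) = Quot.mk _ (T.tip .se) :=
  Quot.sound (.inr ⟨rfl, rfl⟩)

/-- The color interval of `T` has width `h + u`, precisely the determinant after the addition, and
its extremes occur at ends joined by the closure. Only the color of the last crossing lies outside,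
and the closure joins its end to one with a color in the interval. -/
theorem IsBasicColoring.numerator_addRight {ε : Bool} {h u : ℕ} {κ : T.Edge → ℤ} {m : ℤ}
    (hκ : T.IsBasicColoring ε h u κ m) (hu : 0 < u) (hp : (h + u).Prime)
    (C : (T.addRight ε).numerator.Coloring (ZMod (h + u))) (hC : C.Nontrivial) :
    Function.Injective C.color ∧
      (Set.range C.color).ncard = (T.addRight ε).numerator.numCrossings := by
  have hκ' := hκ.addRight hu
  have ⟨h1, h2, h3, h4, _, _, _, _, _⟩ := hκ'
  have hlo := hκ.lower
  have hup := hκ.upper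
  cases ε <;> simp only [cond_true, cond_false] at h1 h2 h3 h4
  · refine hκ'.numerator (m₁ := m) .se .sw .ne .nw (numerator_edge_bottom _).symm
      (numerator_edge_top _).symm ?_ ?_ ?_ ?_ ?_ ?_ hp C hC <;> try omega
    rw [h4]
    rintro (e | _ | _)
    · exact .inr ⟨hlo e, (hup e).trans (by simp [add_assoc])⟩
    · left; simp; ring
    · right; simp; omega
  · refine hκ'.numerator (m₁ := m) .ne .nw .se .sw (numerator_edge_top _).symm
      (numerator_edge_bottom _).symm ?_ ?_ ?_ ?_ ?_ ?_ hp C hC <;> try omega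
    rw [h2]
    rintro (e | _ | _)
    · exact .inr ⟨hlo e, (hup e).trans (by simp [add_assoc])⟩
    · right; simp; omega
    · left; simp; ring

theorem IsBasicColoring.numerator_addLeft {ε : Bool} {h u : ℕ} {κ : T.Edge → ℤ} {m : ℤ}
    (hκ : T.IsBasicColoring ε h u κ m) (hu : 0 < u) (hp : (h + u).Prime)
    (C : (T.addLeft ε).numerator.Coloring (ZMod (h + u))) (hC : C.Nontrivial) :
    Function.Injective C.color ∧
      (Set.range C.color).ncard = (T.addLeft ε).numerator.numCrossings := by
  have hκ' := hκ.addLeft hu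
  have ⟨h1, h2, h3, h4, _, _, _, _, _⟩ := hκ'
  have hlo := hκ.lower
  have hup := hκ.upper
  cases ε <;> simp only [cond_true, cond_false] at h1 h2 h3 h4
  -- The window is again that of `T`, starting at `m`, although the colors of the sum start at `m -
  -- u`.
  · refine hκ'.numerator (m₁ := m) .nw .ne .se .sw (numerator_edge_top _)
      (numerator_edge_bottom _).symm ?_ ?_ ?_ ?_ ?_ ?_ hp C hC <;> try omega
    rw [h1]
    rintro (e | _ | _)
    · exact .inr ⟨hlo e, (hup e).trans (by simp [add_assoc])⟩
    · right; simp; omega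
    · left; simp
  · refine hκ'.numerator (m₁ := m) .sw .se .ne .nw (numerator_edge_bottom _)
      (numerator_edge_top _).symm ?_ ?_ ?_ ?_ ?_ ?_ hp C hC <;> try omega
    rw [h3]
    rintro (e | _ | _)
    · exact .inr ⟨hlo e, (hup e).trans (by simp [add_assoc])⟩
    · left; simp
    · right; simp; omega

/-- Only the last operation matters: a vertical one leaves a nugatory crossing in the closure, `[0]`
closes to two circles, and `[∞]` has determinant `1`. -/
theorem IsAlternatingTwist.numerator {ε : Bool} {h u : ℕ} (hT : T.IsAlternatingTwist ε h u)
    (hred : T.numerator.Reduced) (hp : h.Prime) (C : T.numerator.Coloring (ZMod h))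
    (hC : C.Nontrivial) :
    Function.Injective C.color ∧ (Set.range C.color).ncard = T.numerator.numCrossings := by
  cases hT with
  | zero => exact (not_connected_numerator_zero hred.1).elim
  | infty => exact (Nat.not_prime_one hp).elim
  | addRight hu hT =>
    obtain ⟨κ, m, hκ⟩ := hT.exists_isBasicColoring
    exact hκ.numerator_addRight hu hp C hC
  | addLeft hu hT =>
    obtain ⟨κ, m, hκ⟩ := hT.exists_isBasicColoring
    exact hκ.numerator_addLeft hu hp C hC
  | mulBottom => exact (hred.2 _ (isNugatory_numerator_mulBottom _ ε)).elim
  | mulTop => exact (hred.2 _ (isNugatory_numerator_mulTop _ ε)).elim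

end TangleDiagram

theorem theorem5 (T : TangleDiagram) (hT : T.IsTwistForm) (hAlt : T.Alternating) :
    (T.IsReduced →
      ∀ C : T.toDiagram.Coloring ℤ, C.Nontrivial → Function.Injective C.color) ∧
    (T.numerator.Reduced →
      ∀ p : ℕ, p.Prime → T.numerator.determinant = p →
        ∀ C : T.numerator.Coloring (ZMod p), C.Nontrivial →
          Function.Injective C.color ∧
          (Set.range C.color).ncard = T.numerator.numCrossings) := by
  constructor
  · intro hred C hC
    obtain ⟨ε, h, u, hTw⟩ := TangleDiagram.exists_isAlternatingTwist hT hAlt hred.2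
    obtain ⟨κ, m, hκ⟩ := hTw.exists_isBasicColoring
    exact hκ.injective_color C hC
  · intro hred p hp hdet C hC
    obtain ⟨ε, h, u, hTw⟩ := TangleDiagram.exists_isAlternatingTwist hT hAlt
      fun c hc => hred.2 c hc.numerator
    obtain rfl : h = p := by
      rw [hTw.determinant_numerator] at hdet
      exact_mod_cast hdet
    exact hTw.numerator hred hp C hC
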